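/- For real numbers $\lambda_1\le\dots\le\lambda_n$ let $GZ(\lambda_1\dots\lambda_n)\subset\mathbb R^{n(n-1)/2}$ be the Gelfand–Tsetlin polytope: the set of all $(u_{i,j})_{1\le i\le n-1,\ 1\le j\le n-i}$ such that, with $u_{0,j}:=\lambda_j$, $$u_{i,j}\le u_{i+1,j}\le u_{i,j+1}\qquad\text{for all } i\ge 0,\ j\ge 1 \text{ with } i+1+j\le n .$$ Exponents denote repetition: $GZ(1\,2\,3^k)=GZ(1,2,\underbrace{3,\dots,3}_{k})$ and $GZ(2^2\,3^k)=GZ(2,2,\underbrace{3,\dots,3}_{k})$. For a polytope $P$ of dimension $d$ let $f_i$ be the number of its nonempty $i$-dimensional faces ($P$ itself included, so $f_d=1$), let $f_P(t)=\sum_{i=0}^{d}f_it^i$ be its $f$-polynomial, and let $h_P(s)=f_P(s-1)$ be its $h$-polynomial. Then the following identities hold in the ring $\mathbb Z[s][[z]]$ of formal power series in $z$, where the denominators are invertible: (A) $$\sum_{k=0}^{\infty}h_{GZ(1\,2\,3^k)}(s)\,z^k=\frac{-sz+s+1}{(1-z)(1-sz)\bigl(s^2z^2-(s^2+s)z+1\bigr)};$$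 (B) $$\sum_{k=0}^{\infty}h_{GZ(2^2\,3^k)}(s)\,z^k=\frac{-sz+1}{(1-z)(1-sz)\bigl(s^2z^2-(s^2+s)z+1\bigr)}.$$ -/

import Mathlib

/-- Positions `(i, j)` of the free entries `u_{i,j}` of the triangular table with first row of
length `s`: `1 ≤ i ≤ s - 1` and `1 ≤ j ≤ s - i`. There are `s (s - 1) / 2` of them. -/
abbrev GZIndex (s : ℕ) : Type :=
  {p : ℕ × ℕ // 1 ≤ p.1 ∧ 1 ≤ p.2 ∧ p.1 + p.2 ≤ s}

/-- The entry in row `i ≥ 0` and place `j`, `1 ≤ j ≤ s - i`, of the triangular table: row `0` is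
`λ_1, …, λ_s` (stored as `lam 0, …, lam (s - 1)`), and row `i ≥ 1` is
`u_{i,1}, …, u_{i,s-i}`. -/
def gzEntry {s : ℕ} (lam : Fin s → ℝ) (u : GZIndex s → ℝ) :
    (i j : ℕ) → 1 ≤ j → i + j ≤ s → ℝ
  | 0, j, hj, h => lam ⟨j - 1, by omega⟩
  | i + 1, j, hj, h => u ⟨(i + 1, j), by simp, hj, h⟩

/-- The Gelfand–Tsetlin polytope `GZ(λ_1 … λ_s)` in `ℝ^{s(s-1)/2}`: every triangle
`a   c`
`  b  `
of neighbouring entries of the table satisfies `a ≤ b ≤ c`. -/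
def GZ {s : ℕ} (lam : Fin s → ℝ) : Set (GZIndex s → ℝ) :=
  {u | ∀ (i j : ℕ) (hj : 1 ≤ j) (h : i + 1 + j ≤ s),
    gzEntry lam u i j hj (by omega) ≤ gzEntry lam u (i + 1) j hj h ∧
    gzEntry lam u (i + 1) j hj h ≤ gzEntry lam u i (j + 1) (by omega) (by omega)}

section Polytope

variable {E : Type*} [AddCommGroup E] [Module ℝ E] [TopologicalSpace E]

/-- The dimension of (the affine hull of) a nonempty set. -/
noncomputable def polytopeDim (P : Set E) : ℕ :=
  Module.finrank ℝ (vectorSpan ℝ P)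

/-- The nonempty faces of a polytope: the nonempty sets of the form
`{x ∈ P | l x = max_P l}` with `l` a linear functional; `l = 0` gives `P` itself. -/
def polytopeFaces (P : Set E) : Set (Set E) :=
  {F | F.Nonempty ∧ IsExposed ℝ P F}

/-- The number `f_i` of faces of dimension `i`. -/
noncomputable def faceCount (P : Set E) (i : ℕ) : ℕ :=
  {F ∈ polytopeFaces P | polytopeDim F = i}.ncard

/-- The `f`-polynomial `f_0 + f_1 t + … + f_n t^n`, where `n = dim P`. -/
noncomputable def fPolynomial (P : Set E) : Polynomial ℤ :=
  ∑ i ∈ Finset.range (polytopeDim P + 1),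
    Polynomial.C (faceCount P i : ℤ) * Polynomial.X ^ i

/-- The `h`-polynomial `h(s) = f(s - 1)`. -/
noncomputable def hPolynomial (P : Set E) : Polynomial ℤ :=
  (fPolynomial P).comp (Polynomial.X - 1)

end Polytope

/-- The sequence `1 2 3^k`. -/
def seq123 (k : ℕ) : Fin (2 + k) → ℝ :=
  Fin.append ![1, 2] (fun _ : Fin k => 3)

/-- The sequence `2^2 3^k`. -/
def seq223 (k : ℕ) : Fin (2 + k) → ℝ :=
  Fin.append ![2, 2] (fun _ : Fin k => 3)

/-- The variable `s` in the ring `ℤ[s]⟦z⟧` of formal power series in `z` over `ℤ[s]`. -/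
noncomputable abbrev sVar : PowerSeries (Polynomial ℤ) := PowerSeries.C Polynomial.X

/-- The variable `z` in `ℤ[s]⟦z⟧`. -/
noncomputable abbrev zVar : PowerSeries (Polynomial ℤ) := PowerSeries.X

/-- The denominator `(1 - z)(1 - sz)(s²z² - (s² + s)z + 1)`. -/
noncomputable def gzDenominator : PowerSeries (Polynomial ℤ) :=
  (1 - zVar) * (1 - sVar * zVar) * (sVar ^ 2 * zVar ^ 2 - (sVar ^ 2 + sVar) * zVar + 1)

/-! A nonempty face of a polyhedron is determined by the inequalities tight at a relative interior
point, and its dimension is that of the space of directions keeping them tight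
(`fPolynomial_polyhedron_eq_sum`). In a Gelfand–Tsetlin table an entry equal to an upper neighbour
is determined by it, so the dimension is the number of entries different from both upper neighbours
(`finrank_tightDirection_GZ`).

For the first row `α, 2, 3^k` all columns from the third on are constantly 3. The first two columns,
the second shifted by one row, form a ladder of pairs with `x ≤ x' ≤ y'` and `y ≤ y' ≤ 3`. The
equalities possible in a step depend only on whether `x = y` and whether `y = 3`. Hence faces are
words of a four-state automaton, weighted by the number of free moves (`fPolynomial_GZ_ladderSeq`).

Reading off the first letter gives linear recurrences, hence a linear system over `ℤ[s]⟦z⟧` with `s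
= t + 1`. Let P and Q be the series of the states `x < y < 3` and `x = y < 3`. Then Q = (1 - sz)P,
and P is the inverse of the denominator. The first step keeps `y = 2`, so (A) is sP + Q and (B) is
Q. -/

/-! ### Faces of a polyhedron and their tight inequalities. -/

section Polyhedron

open Filter Topology

variable {E : Type*} [AddCommGroup E] [Module ℝ E] [TopologicalSpace E] {ι : Type*}

/-- The polyhedron cut out by the inequalities `ℓ i x ≤ c i`. -/
def polyhedron (ℓ : ι → E →L[ℝ] ℝ) (c : ι → ℝ) : Set E :=
  {x | ∀ i, ℓ i x ≤ c i}

/-- The points of the polyhedron at which all the inequalities tight at `x` are tight. -/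
def tightFace (ℓ : ι → E →L[ℝ] ℝ) (c : ι → ℝ) (x : E) : Set E :=
  {y ∈ polyhedron ℓ c | ∀ i, ℓ i x = c i → ℓ i y = c i}

/-- The directions along which all the inequalities tight at `x` remain tight. -/
def tightDirection (ℓ : ι → E →L[ℝ] ℝ) (c : ι → ℝ) (x : E) : Submodule ℝ E where
  carrier := {v | ∀ i, ℓ i x = c i → ℓ i v = 0}
  add_mem' ha hb i hi := by simp [ha i hi, hb i hi]
  zero_mem' i _ := by simp
  smul_mem' r v hv i hi := by simp [hv i hi]

variable {ℓ : ι → E →L[ℝ] ℝ} {c : ι → ℝ}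

theorem mem_tightFace_self {x : E} (hx : x ∈ polyhedron ℓ c) : x ∈ tightFace ℓ c x :=
  ⟨hx, fun _ h => h⟩

theorem tightFace_eq_iff {x y : E} (hx : x ∈ polyhedron ℓ c) (hy : y ∈ polyhedron ℓ c) :
    tightFace ℓ c x = tightFace ℓ c y ↔ ∀ i, ℓ i x = c i ↔ ℓ i y = c i := by
  constructor
  · intro h i
    have h1 : x ∈ tightFace ℓ c y := h ▸ mem_tightFace_self hx
    have h2 : y ∈ tightFace ℓ c x := h ▸ mem_tightFace_self hy
    exact ⟨h2.2 i, h1.2 i⟩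
  · intro h
    ext z
    simp only [tightFace, h]

/-- The finitely many inequalities strict at `x` survive a short move, and the tight ones do not
change along `v`. -/
theorem exists_pos_add_smul_mem_tightFace [Finite ι] {x v : E} (hx : x ∈ polyhedron ℓ c)
    (hv : v ∈ tightDirection ℓ c x) : ∃ ε : ℝ, 0 < ε ∧ x + ε • v ∈ tightFace ℓ c x := by
  have key : ∀ᶠ ε : ℝ in 𝓝[>] 0, ∀ i, ℓ i (x + ε • v) ≤ c i := by
    rw [eventually_all]
    intro i
    by_cases hi : ℓ i x = c i
    · refine Eventually.of_forall fun ε => ?_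
      simp [hv i hi, hi]
    · have hlt : ℓ i x < c i := lt_of_le_of_ne (hx i) hi
      have ht : Tendsto (fun ε : ℝ => ℓ i x + ε * ℓ i v) (𝓝[>] 0) (𝓝 (ℓ i x + 0 * ℓ i v)) :=
        Tendsto.mono_left (Continuous.tendsto (by fun_prop) 0) nhdsWithin_le_nhds
      rw [zero_mul, add_zero] at ht
      filter_upwards [ht.eventually_lt_const hlt] with ε hε
      simpa using hε.le
  obtain ⟨ε, h1, h2⟩ := (key.and self_mem_nhdsWithin).exists
  exact ⟨ε, h2, h1, fun i hi => by simp [hv i hi, hi]⟩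

/-- The sum of the functionals tight at `x` attains its maximum exactly where each summand does. -/
theorem isExposed_tightFace [Finite ι] {x : E} (hx : x ∈ polyhedron ℓ c) :
    IsExposed ℝ (polyhedron ℓ c) (tightFace ℓ c x) := by
  classical
  have := Fintype.ofFinite ι
  intro _
  refine ⟨∑ i with ℓ i x = c i, ℓ i, ?_⟩
  have happ : ∀ y, (∑ i with ℓ i x = c i, ℓ i) y = ∑ i with ℓ i x = c i, ℓ i y := by
    intro y; simp
  ext y
  constructor
  · rintro ⟨hy, h⟩
    refine ⟨hy, fun z hz => ?_⟩
    rw [happ, happ]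
    refine Finset.sum_le_sum fun i hi => ?_
    rw [h i (by simpa using hi)]
    exact hz i
  · rintro ⟨hy, h⟩
    refine ⟨hy, ?_⟩
    have h1 := h x hx
    rw [happ, happ] at h1
    have h2 : ∑ i with ℓ i x = c i, ℓ i y = ∑ i with ℓ i x = c i, ℓ i x := by
      refine le_antisymm (Finset.sum_le_sum fun i hi => ?_) h1
      rw [(Finset.mem_filter.1 hi).2]
      exact hy i
    have h3 := (Finset.sum_eq_sum_iff_of_le (s := Finset.univ.filter fun i => ℓ i x = c i)
      (f := fun i => ℓ i y) (g := fun i => ℓ i x) (fun i hi => by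
        rw [(Finset.mem_filter.1 hi).2]
        exact hy i)).1 h2
    intro i hi
    rw [h3 i (by simpa using hi), hi]

/-- A point of `F` with the fewest tight inequalities plays the role of a relative interior point.
-/
theorem exists_eq_tightFace [Finite ι] {F : Set E} (hF : F.Nonempty)
    (hexp : IsExposed ℝ (polyhedron ℓ c) F) :
    ∃ x ∈ polyhedron ℓ c, F = tightFace ℓ c x := by
  obtain ⟨l, rfl⟩ := hexp hF
  obtain ⟨x, hx, hmin⟩ := WellFounded.has_min
    (InvImage.wf (fun x : E => {i | ℓ i x = c i}.ncard) Nat.lt_wfRel.wf) _ hF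
  refine ⟨x, hx.1, ?_⟩
  ext y
  constructor
  · rintro ⟨hy, hly⟩
    refine ⟨hy, ?_⟩
    -- The midpoint lies in `F` and is tight only where both `x` and `y` are; by minimality of `x`
    -- its tight set is that of `x`, so `y` is tight there too.
    have hmid : (2⁻¹ : ℝ) • x + (2⁻¹ : ℝ) • y ∈
        {x ∈ polyhedron ℓ c | ∀ y ∈ polyhedron ℓ c, l y ≤ l x} := by
      refine ⟨fun i => ?_, fun z hz => ?_⟩
      · have h1 := hx.1 i
        have h2 := hy i
        simp only [map_add, map_smul, smul_eq_mul]
        linarith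
      · have h1 := hx.2 z hz
        have h2 := hly z hz
        simp only [map_add, map_smul, smul_eq_mul]
        linarith
    have htight : ∀ i, ℓ i ((2⁻¹ : ℝ) • x + (2⁻¹ : ℝ) • y) = c i → ℓ i x = c i ∧ ℓ i y = c i := by
      intro i hi
      have h1 := hx.1 i
      have h2 := hy i
      simp only [map_add, map_smul, smul_eq_mul] at hi
      constructor <;> linarith
    have hsub : {i | ℓ i ((2⁻¹ : ℝ) • x + (2⁻¹ : ℝ) • y) = c i} ⊆ {i | ℓ i x = c i} :=
      fun i hi => (htight i hi).1
    have heq := Set.eq_of_subset_of_ncard_le hsub (not_lt.1 (hmin _ hmid)) (Set.toFinite _)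
    intro i hi
    have hi' : i ∈ {i | ℓ i x = c i} := hi
    rw [← heq] at hi'
    exact (htight i hi').2
  · rintro ⟨hy, h⟩
    refine ⟨hy, fun z hz => ?_⟩
    -- The segment from `y` to `x` can be prolonged beyond `x`; if `l y < l x`, then `l` would
    -- exceed its maximum there.
    have hv : x - y ∈ tightDirection ℓ c x := fun i hi => by simp [hi, h i hi]
    obtain ⟨ε, hε, hmem⟩ := exists_pos_add_smul_mem_tightFace hx.1 hv
    have h1 := hx.2 _ hmem.1
    simp only [map_add, map_smul, map_sub, smul_eq_mul] at h1
    have h2 := hx.2 z hz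
    have h3 : l x ≤ l y := by
      by_contra hlt
      have := mul_pos hε (sub_pos.2 (not_le.1 hlt))
      linarith
    exact h2.trans h3

theorem polytopeFaces_polyhedron [Finite ι] :
    polytopeFaces (polyhedron ℓ c) = tightFace ℓ c '' polyhedron ℓ c := by
  ext F
  constructor
  · rintro ⟨hF, hexp⟩
    obtain ⟨x, hx, rfl⟩ := exists_eq_tightFace hF hexp
    exact ⟨x, hx, rfl⟩
  · rintro ⟨x, hx, rfl⟩
    exact ⟨⟨x, mem_tightFace_self hx⟩, isExposed_tightFace hx⟩

theorem vectorSpan_tightFace [Finite ι] {x : E} (hx : x ∈ polyhedron ℓ c) :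
    vectorSpan ℝ (tightFace ℓ c x) = tightDirection ℓ c x := by
  apply le_antisymm
  · rw [vectorSpan_def, Submodule.span_le]
    rintro _ ⟨y, hy, z, hz, rfl⟩ i hi
    simp [hy.2 i hi, hz.2 i hi]
  · intro v hv
    obtain ⟨ε, hε, hmem⟩ := exists_pos_add_smul_mem_tightFace hx hv
    have h := vsub_mem_vectorSpan ℝ hmem (mem_tightFace_self hx)
    have h2 := Submodule.smul_mem _ ε⁻¹ h
    simpa [smul_smul, hε.ne'] using h2

/-- If `code` classifies the points of a polyhedron by their sets of tight inequalities, then the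
`f`-polynomial enumerates the codes by the dimensions of the corresponding faces. -/
theorem fPolynomial_polyhedron_eq_sum [FiniteDimensional ℝ E] [Finite ι] {C : Type*} (W : Finset C)
    (code : E → C) (d : C → ℕ) (hmaps : ∀ x ∈ polyhedron ℓ c, code x ∈ W)
    (hsurj : ∀ w ∈ W, ∃ x ∈ polyhedron ℓ c, code x = w)
    (hcode : ∀ x ∈ polyhedron ℓ c, ∀ y ∈ polyhedron ℓ c,
      (code x = code y ↔ ∀ i, ℓ i x = c i ↔ ℓ i y = c i))
    (hd : ∀ x ∈ polyhedron ℓ c, Module.finrank ℝ (tightDirection ℓ c x) = d (code x)) :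
    fPolynomial (polyhedron ℓ c) = ∑ w ∈ W, Polynomial.X ^ d w := by
  classical
  choose! pt hpt hcpt using hsurj
  have hdim : ∀ w ∈ W, polytopeDim (tightFace ℓ c (pt w)) = d w := by
    intro w hw
    rw [polytopeDim, vectorSpan_tightFace (hpt w hw), hd _ (hpt w hw), hcpt w hw]
  have hle : ∀ w ∈ W, d w < polytopeDim (polyhedron ℓ c) + 1 := by
    intro w hw
    rw [← hdim w hw, Nat.lt_succ_iff]
    exact Submodule.finrank_mono (vectorSpan_mono ℝ fun y hy => hy.1)
  have hcount : ∀ i, faceCount (polyhedron ℓ c) i = (W.filter fun w => d w = i).card := by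
    intro i
    rw [faceCount, polytopeFaces_polyhedron, ← Set.ncard_coe_finset]
    symm
    refine Set.ncard_congr (fun w _ => tightFace ℓ c (pt w)) ?_ ?_ ?_
    · intro w hw
      have hw' := Finset.mem_filter.1 (Finset.mem_coe.1 hw)
      exact ⟨⟨_, hpt w hw'.1, rfl⟩, (hdim w hw'.1).trans hw'.2⟩
    · intro w w' hw hw' h
      have hw1 := (Finset.mem_filter.1 (Finset.mem_coe.1 hw)).1
      have hw2 := (Finset.mem_filter.1 (Finset.mem_coe.1 hw')).1
      rw [tightFace_eq_iff (hpt w hw1) (hpt w' hw2), ← hcode _ (hpt w hw1) _ (hpt w' hw2),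
        hcpt w hw1, hcpt w' hw2] at h
      exact h
    · rintro _ ⟨⟨x, hx, rfl⟩, hxd⟩
      have hw := hmaps x hx
      have heq : tightFace ℓ c (pt (code x)) = tightFace ℓ c x := by
        rw [tightFace_eq_iff (hpt _ hw) hx, ← hcode _ (hpt _ hw) _ hx, hcpt _ hw]
      refine ⟨code x, ?_, heq⟩
      rw [Finset.mem_coe, Finset.mem_filter]
      refine ⟨hw, ?_⟩
      rw [← hdim _ hw, heq, hxd]
  rw [fPolynomial, ← Finset.sum_fiberwise_of_maps_to (t := Finset.range
    (polytopeDim (polyhedron ℓ c) + 1)) (g := d) (fun w hw => Finset.mem_range.2 (hle w hw))]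
  refine Finset.sum_congr rfl fun i _ => ?_
  rw [hcount, Finset.sum_congr rfl fun w hw => by rw [(Finset.mem_filter.1 hw).2],
    Finset.sum_const]
  simp

end Polyhedron

/-! ### Face dimensions of general Gelfand–Tsetlin polytopes. -/

section GelfandTsetlin

variable {s : ℕ}

instance : Finite (GZIndex s) :=
  Set.Finite.to_subtype <| ((Set.finite_Iic s).prod (Set.finite_Iic s)).subset
    fun p hp => by
      obtain ⟨h1, h2, h3⟩ := hp
      exact ⟨by simp only [Set.mem_Iic]; omega, by simp only [Set.mem_Iic]; omega⟩

/-- The table of entries, extended by `0` to all pairs of natural numbers. -/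
def gzTab (lam : Fin s → ℝ) (u : GZIndex s → ℝ) (i j : ℕ) : ℝ :=
  if h : 1 ≤ j ∧ i + j ≤ s then gzEntry lam u i j h.1 h.2 else 0

theorem gzTab_of_le (lam : Fin s → ℝ) (u : GZIndex s → ℝ) {i j : ℕ} (hj : 1 ≤ j)
    (h : i + j ≤ s) : gzTab lam u i j = gzEntry lam u i j hj h :=
  dif_pos ⟨hj, h⟩

theorem gzTab_zero (lam : Fin s → ℝ) (u : GZIndex s → ℝ) {j : ℕ} (hj : 1 ≤ j)
    (h : j ≤ s) : gzTab lam u 0 j = lam ⟨j - 1, by omega⟩ := by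
  rw [gzTab_of_le lam u hj (by omega), gzEntry]

theorem gzTab_succ (lam : Fin s → ℝ) (u : GZIndex s → ℝ) {i j : ℕ} (hj : 1 ≤ j)
    (h : i + 1 + j ≤ s) : gzTab lam u (i + 1) j = u ⟨(i + 1, j), by simp, hj, h⟩ := by
  rw [gzTab_of_le lam u hj h, gzEntry]

theorem gzTab_coe (lam : Fin s → ℝ) (u : GZIndex s → ℝ) (p : GZIndex s) :
    gzTab lam u p.1.1 p.1.2 = u p := by
  obtain ⟨⟨_ | i, j⟩, h1, h2, h3⟩ := p
  · simp at h1
  · exact gzTab_succ lam u h2 h3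

theorem gzTab_add (lam mu : Fin s → ℝ) (u v : GZIndex s → ℝ) (i j : ℕ) :
    gzTab (lam + mu) (u + v) i j = gzTab lam u i j + gzTab mu v i j := by
  unfold gzTab
  split_ifs with h
  · cases i <;> simp [gzEntry]
  · simp

theorem gzTab_smul (r : ℝ) (lam : Fin s → ℝ) (u : GZIndex s → ℝ) (i j : ℕ) :
    gzTab (r • lam) (r • u) i j = r * gzTab lam u i j := by
  unfold gzTab
  split_ifs with h
  · cases i <;> simp [gzEntry]
  · simp

theorem mem_GZ_iff {lam : Fin s → ℝ} {u : GZIndex s → ℝ} :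
    u ∈ GZ lam ↔ ∀ i j, 1 ≤ j → i + 1 + j ≤ s →
      gzTab lam u i j ≤ gzTab lam u (i + 1) j ∧
        gzTab lam u (i + 1) j ≤ gzTab lam u i (j + 1) := by
  refine forall₄_congr fun i j hj h => ?_
  rw [gzTab_of_le lam u hj (by omega), gzTab_of_le lam u hj h,
    gzTab_of_le lam u (by omega) (by omega)]

/-- The two inequalities at `p`, as differences which have to be nonpositive: the lower bound for
`u p` has index `(p, false)`, the upper bound has index `(p, true)`. -/
def gzGap (lam : Fin s → ℝ) (u : GZIndex s → ℝ) (q : GZIndex s × Bool) : ℝ :=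
  if q.2 then gzTab lam u q.1.1.1 q.1.1.2 - gzTab lam u (q.1.1.1 - 1) (q.1.1.2 + 1)
  else gzTab lam u (q.1.1.1 - 1) q.1.1.2 - gzTab lam u q.1.1.1 q.1.1.2

theorem gzGap_false (lam : Fin s → ℝ) (u : GZIndex s → ℝ) {i j : ℕ}
    (h : 1 ≤ i + 1 ∧ 1 ≤ j ∧ i + 1 + j ≤ s) :
    gzGap lam u (⟨(i + 1, j), h⟩, false) = gzTab lam u i j - gzTab lam u (i + 1) j := by
  simp [gzGap]

theorem gzGap_true (lam : Fin s → ℝ) (u : GZIndex s → ℝ) {i j : ℕ}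
    (h : 1 ≤ i + 1 ∧ 1 ≤ j ∧ i + 1 + j ≤ s) :
    gzGap lam u (⟨(i + 1, j), h⟩, true) = gzTab lam u (i + 1) j - gzTab lam u i (j + 1) := by
  simp [gzGap]

theorem forall_gzIndex_bool {P : GZIndex s × Bool → Prop} :
    (∀ q, P q) ↔ ∀ i j (hj : 1 ≤ j) (h : i + 1 + j ≤ s),
      P (⟨(i + 1, j), by simp, hj, h⟩, false) ∧ P (⟨(i + 1, j), by simp, hj, h⟩, true) := by
  constructor
  · exact fun H i j hj h => ⟨H _, H _⟩
  · rintro H ⟨⟨⟨_ | i, j⟩, h1, h2, h3⟩, _ | _⟩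
    · simp at h1
    · simp at h1
    · exact (H i j h2 h3).1
    · exact (H i j h2 h3).2

theorem gzGap_add (lam mu : Fin s → ℝ) (u v : GZIndex s → ℝ) (q : GZIndex s × Bool) :
    gzGap (lam + mu) (u + v) q = gzGap lam u q + gzGap mu v q := by
  unfold gzGap
  split_ifs <;> simp only [gzTab_add] <;> ring

theorem gzGap_smul (r : ℝ) (lam : Fin s → ℝ) (u : GZIndex s → ℝ) (q : GZIndex s × Bool) :
    gzGap (r • lam) (r • u) q = r * gzGap lam u q := by
  unfold gzGap
  split_ifs <;> simp only [gzTab_smul] <;> ring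

/-- The linear part of `gzGap lam · q`. -/
noncomputable def gzGapLinear (q : GZIndex s × Bool) : (GZIndex s → ℝ) →L[ℝ] ℝ :=
  LinearMap.toContinuousLinearMap
    { toFun := fun u => gzGap 0 u q
      map_add' := fun u v => by simpa using gzGap_add 0 0 u v q
      map_smul' := fun r u => by simpa using gzGap_smul r 0 u q }

theorem gzGapLinear_apply (q : GZIndex s × Bool) (u : GZIndex s → ℝ) :
    gzGapLinear q u = gzGap 0 u q :=
  rfl

theorem gzGap_eq (lam : Fin s → ℝ) (u : GZIndex s → ℝ) (q : GZIndex s × Bool) :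
    gzGap lam u q = gzGapLinear q u - -gzGap lam 0 q := by
  rw [gzGapLinear_apply, sub_neg_eq_add, add_comm]
  simpa using gzGap_add lam 0 0 u q

theorem gzGapLinear_eq_iff {lam : Fin s → ℝ} {u : GZIndex s → ℝ} {q : GZIndex s × Bool} :
    gzGapLinear q u = -gzGap lam 0 q ↔ gzGap lam u q = 0 := by
  rw [gzGap_eq lam u, sub_eq_zero]

theorem GZ_eq_polyhedron (lam : Fin s → ℝ) :
    GZ lam = polyhedron gzGapLinear (fun q => -gzGap lam 0 q) := by
  ext u
  have h : u ∈ polyhedron gzGapLinear (fun q => -gzGap lam 0 q) ↔ ∀ q, gzGap lam u q ≤ 0 :=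
    forall_congr' fun q => by rw [gzGap_eq lam u, sub_nonpos]
  rw [h, mem_GZ_iff, forall_gzIndex_bool]
  refine forall₄_congr fun i j hj h => ?_
  rw [gzGap_false, gzGap_true, sub_nonpos, sub_nonpos]

/-- The positions at which none of the two inequalities is tight. -/
def gzFree (lam : Fin s → ℝ) (u : GZIndex s → ℝ) : Set (GZIndex s) :=
  {p | gzGap lam u (p, false) ≠ 0 ∧ gzGap lam u (p, true) ≠ 0}

open Classical in
/-- The table whose entries at the free positions are those of `g`, and whose other entries are
copied from a neighbour above according to the tight inequalities of `u`. -/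
noncomputable def gzExtend (lam : Fin s → ℝ) (u : GZIndex s → ℝ) (g : GZIndex s → ℝ) :
    ℕ → ℕ → ℝ
  | 0, _ => 0
  | i + 1, j =>
    if gzTab lam u i j = gzTab lam u (i + 1) j then gzExtend lam u g i j
    else if gzTab lam u (i + 1) j = gzTab lam u i (j + 1) then gzExtend lam u g i (j + 1)
    else if h : 1 ≤ j ∧ i + 1 + j ≤ s then g ⟨(i + 1, j), by simp, h.1, h.2⟩ else 0

open Classical in
theorem gzExtend_succ (lam : Fin s → ℝ) (u g : GZIndex s → ℝ) (i j : ℕ) :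
    gzExtend lam u g (i + 1) j =
      if gzTab lam u i j = gzTab lam u (i + 1) j then gzExtend lam u g i j
      else if gzTab lam u (i + 1) j = gzTab lam u i (j + 1) then gzExtend lam u g i (j + 1)
      else if h : 1 ≤ j ∧ i + 1 + j ≤ s then g ⟨(i + 1, j), by simp, h.1, h.2⟩ else 0 :=
  rfl

theorem gzTab_gzExtend (lam : Fin s → ℝ) (u g : GZIndex s → ℝ) {i j : ℕ} (hj : 1 ≤ j)
    (h : i + j ≤ s) :
    gzTab 0 (fun p : GZIndex s => gzExtend lam u g p.1.1 p.1.2) i j = gzExtend lam u g i j := by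
  cases i with
  | zero => rw [gzTab_zero _ _ hj (by omega), gzExtend]; rfl
  | succ i => rw [gzTab_succ _ _ hj h]

/-- Only an entry tied to both upper neighbours could cause a conflict. Those neighbours are then
equal in `u`, so the entry of the row above lying between them equals both, and by induction the
copied values agree. In row 0 all values are 0. -/
theorem gzExtend_tight {lam : Fin s → ℝ} {u : GZIndex s → ℝ} (hu : u ∈ GZ lam)
    (g : GZIndex s → ℝ) (i : ℕ) : ∀ j, 1 ≤ j → i + 1 + j ≤ s →
      (gzTab lam u i j = gzTab lam u (i + 1) j →
        gzExtend lam u g (i + 1) j = gzExtend lam u g i j) ∧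
      (gzTab lam u (i + 1) j = gzTab lam u i (j + 1) →
        gzExtend lam u g (i + 1) j = gzExtend lam u g i (j + 1)) := by
  rw [mem_GZ_iff] at hu
  induction i with
  | zero =>
    intro j hj h
    rw [gzExtend_succ]
    refine ⟨fun h1 => if_pos h1, fun h2 => ?_⟩
    rw [if_pos h2]
    split_ifs <;> rfl
  | succ i ih =>
    intro j hj h
    rw [gzExtend_succ]
    refine ⟨fun h1 => if_pos h1, fun h2 => ?_⟩
    rw [if_pos h2]
    split_ifs with h1
    · have a := hu i j hj (by omega)
      have b := hu i (j + 1) (by omega) (by omega)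
      rw [(ih j hj (by omega)).2 (by linarith), (ih (j + 1) (by omega) (by omega)).1 (by linarith)]
    · rfl

/-- Restriction to the free positions is an isomorphism: it is injective because the other entries
are copied downwards from the zero row or from free entries, and surjective by `gzExtend`. -/
theorem finrank_tightDirection_GZ {lam : Fin s → ℝ} {u : GZIndex s → ℝ} (hu : u ∈ GZ lam) :
    Module.finrank ℝ (tightDirection gzGapLinear (fun q => -gzGap lam 0 q) u) =
      (gzFree lam u).ncard := by
  classical
  have := Fintype.ofFinite (gzFree lam u)
  set D := tightDirection gzGapLinear (fun q => -gzGap lam 0 q) u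
  have hD : ∀ v, v ∈ D ↔ ∀ i j, 1 ≤ j → i + 1 + j ≤ s →
      (gzTab lam u i j = gzTab lam u (i + 1) j → gzTab 0 v i j = gzTab 0 v (i + 1) j) ∧
      (gzTab lam u (i + 1) j = gzTab lam u i (j + 1) →
        gzTab 0 v (i + 1) j = gzTab 0 v i (j + 1)) := by
    intro v
    have h : v ∈ D ↔ ∀ q, gzGap lam u q = 0 → gzGap 0 v q = 0 :=
      forall_congr' fun q => by rw [gzGapLinear_eq_iff, gzGapLinear_apply]
    rw [h, forall_gzIndex_bool]
    refine forall₄_congr fun i j hj h => ?_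
    rw [gzGap_false, gzGap_true, gzGap_false, gzGap_true]
    simp only [sub_eq_zero]
  let R : D →ₗ[ℝ] (gzFree lam u → ℝ) :=
    (LinearMap.funLeft ℝ ℝ (Subtype.val : gzFree lam u → GZIndex s)).comp D.subtype
  have hR : ∀ v p, R v p = v.1 p.1 := fun _ _ => rfl
  have hinj : Function.Injective R := by
    rw [← LinearMap.ker_eq_bot, LinearMap.ker_eq_bot']
    rintro ⟨v, hv⟩ h0
    rw [hD] at hv
    have key : ∀ i j, 1 ≤ j → i + j ≤ s → gzTab 0 v i j = 0 := by
      intro i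
      induction i with
      | zero => intro j hj h; rw [gzTab_zero _ _ hj (by omega)]; rfl
      | succ i ih =>
        intro j hj h
        by_cases h1 : gzTab lam u i j = gzTab lam u (i + 1) j
        · rw [← (hv i j hj h).1 h1, ih j hj (by omega)]
        by_cases h2 : gzTab lam u (i + 1) j = gzTab lam u i (j + 1)
        · rw [(hv i j hj h).2 h2, ih (j + 1) (by omega) (by omega)]
        rw [gzTab_succ _ _ hj h]
        refine congrFun h0 ⟨⟨(i + 1, j), by simp, hj, h⟩, ?_, ?_⟩
        · rw [gzGap_false, sub_ne_zero]; exact h1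
        · rw [gzGap_true, sub_ne_zero]; exact h2
    ext p
    show v p = 0
    rw [← gzTab_coe 0 v p]
    exact key _ _ p.2.2.1 p.2.2.2
  have hsurj : Function.Surjective R := by
    intro g
    let g' : GZIndex s → ℝ := fun p => if h : p ∈ gzFree lam u then g ⟨p, h⟩ else 0
    refine ⟨⟨fun p => gzExtend lam u g' p.1.1 p.1.2, ?_⟩, ?_⟩
    · rw [hD]
      intro i j hj h
      rw [gzTab_gzExtend _ _ _ hj h, gzTab_gzExtend _ _ _ hj (by omega),
        gzTab_gzExtend _ _ _ (by omega) (by omega)]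
      have := gzExtend_tight hu g' i j hj h
      exact ⟨fun h1 => (this.1 h1).symm, this.2⟩
    · ext p
      rw [hR]
      obtain ⟨⟨⟨_ | i, j⟩, h1, h2, h3⟩, hp⟩ := p
      · simp at h1
      · have hp' := hp
        obtain ⟨ha, hb⟩ := hp'
        rw [gzGap_false, sub_ne_zero] at ha
        rw [gzGap_true, sub_ne_zero] at hb
        show gzExtend lam u g' (i + 1) j = _
        rw [gzExtend_succ, if_neg ha, if_neg hb, dif_pos ⟨h2, h3⟩]
        exact dif_pos hp
  rw [(LinearEquiv.ofBijective R ⟨hinj, hsurj⟩).finrank_eq, Module.finrank_fintype_fun_eq_card,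
    ← Nat.card_eq_fintype_card, Nat.card_coe_set_eq]

/-- The `f`-polynomial of a Gelfand–Tsetlin polytope enumerates codes of the sets of tight
inequalities by the number of free positions. -/
theorem fPolynomial_GZ_eq_sum (lam : Fin s → ℝ) {C : Type*} (W : Finset C)
    (code : (GZIndex s → ℝ) → C) (d : C → ℕ) (hmaps : ∀ u ∈ GZ lam, code u ∈ W)
    (hsurj : ∀ w ∈ W, ∃ u ∈ GZ lam, code u = w)
    (hcode : ∀ u ∈ GZ lam, ∀ v ∈ GZ lam,
      (code u = code v ↔ ∀ i j, 1 ≤ j → i + 1 + j ≤ s →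
        (gzTab lam u i j = gzTab lam u (i + 1) j ↔ gzTab lam v i j = gzTab lam v (i + 1) j) ∧
        (gzTab lam u (i + 1) j = gzTab lam u i (j + 1) ↔
          gzTab lam v (i + 1) j = gzTab lam v i (j + 1))))
    (hd : ∀ u ∈ GZ lam, (gzFree lam u).ncard = d (code u)) :
    fPolynomial (GZ lam) = ∑ w ∈ W, Polynomial.X ^ d w := by
  have hd' : ∀ u ∈ GZ lam,
      Module.finrank ℝ (tightDirection gzGapLinear (fun q => -gzGap lam 0 q) u) = d (code u) :=
    fun u hu => (finrank_tightDirection_GZ hu).trans (hd u hu)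
  have hcode' : ∀ u ∈ GZ lam, ∀ v ∈ GZ lam, (code u = code v ↔ ∀ q : GZIndex s × Bool,
      gzGapLinear q u = -gzGap lam 0 q ↔ gzGapLinear q v = -gzGap lam 0 q) := by
    intro u hu v hv
    rw [hcode u hu v hv, forall_gzIndex_bool]
    refine forall₄_congr fun i j hj h => ?_
    simp only [gzGapLinear_eq_iff]
    simp only [gzGap_false, gzGap_true, sub_eq_zero]
  rw [GZ_eq_polyhedron] at *
  exact fPolynomial_polyhedron_eq_sum W code d hmaps hsurj hcode' hd'

end GelfandTsetlin

/-! ### Ladders of pairs and the automaton of their steps. -/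

section Ladder

/-- A step `(x, y) → (x', y')` of a ladder is recorded by the truth values of `y' = y`, `y' = 3`,
`x' = x` and `x' = y'`. -/
abbrev LadderStep : Type := Bool × Bool × Bool × Bool

/-- The step from `(x, y)` to `(x', y')`. -/
noncomputable def ladderStep (x y x' y' : ℝ) : LadderStep :=
  (decide (y' = y), decide (y' = 3), decide (x' = x), decide (x' = y'))

/-- The truth values of `x = y` and `y = 3`. -/
noncomputable def ladderState (x y : ℝ) : Bool × Bool :=
  (decide (x = y), decide (y = 3))

namespace LadderStep

/-- The steps which are possible from a given state. -/
def Valid (σ : Bool × Bool) (τ : LadderStep) : Prop :=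
  (τ.1 && τ.2.1) = σ.2 ∧ (τ.2.2.1 && τ.2.2.2) = (σ.1 && τ.1)

/-- The state after a step. -/
def target (τ : LadderStep) : Bool × Bool := (τ.2.2.2, τ.2.1)

/-- The number of coordinates which move freely in a step. -/
def weight (τ : LadderStep) : ℕ :=
  (if !τ.1 && !τ.2.1 then 1 else 0) + if !τ.2.2.1 && !τ.2.2.2 then 1 else 0

end LadderStep

open LadderStep

/-- A number squeezed between two bounds equals both only if they coincide: `y = 3` for `y'`, and `x
= y'` for `x'`. As `x ≤ y ≤ y'`, the latter means `x = y` and `y' = y`. -/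
theorem valid_ladderStep {x y x' y' : ℝ} (hxy : x ≤ y) (hxx : x ≤ x') (hxy' : x' ≤ y')
    (hyy : y ≤ y') (hy' : y' ≤ 3) : Valid (ladderState x y) (ladderStep x y x' y') := by
  refine ⟨?_, ?_⟩ <;> rw [Bool.eq_iff_iff] <;>
    simp only [ladderState, ladderStep, Bool.and_eq_true, decide_eq_true_eq]
  · exact ⟨fun h => h.1 ▸ h.2, fun h => by constructor <;> linarith⟩
  · constructor <;> rintro ⟨h1, h2⟩ <;> constructor <;> linarith

/-- First `y'` is chosen in `[y, 3]`, then `x'` in `[x, y']`: an endpoint or the midpoint, as the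
step prescribes. Validity says exactly whether each interval is degenerate. -/
theorem exists_ladderStep_eq {x y : ℝ} (hxy : x ≤ y) (hy : y ≤ 3) {τ : LadderStep}
    (hτ : Valid (ladderState x y) τ) :
    ∃ x' y', x ≤ x' ∧ x' ≤ y' ∧ y ≤ y' ∧ y' ≤ 3 ∧ ladderStep x y x' y' = τ := by
  obtain ⟨yc, yt, xc, xd⟩ := τ
  obtain ⟨h1, h2⟩ := hτ
  simp only [ladderState] at h1 h2
  obtain ⟨y', hyy, hy3, hyc, hyt⟩ :
      ∃ y', y ≤ y' ∧ y' ≤ 3 ∧ decide (y' = y) = yc ∧ decide (y' = 3) = yt := by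
    cases yc <;> cases yt <;> simp at h1
    · have := lt_of_le_of_ne hy h1
      refine ⟨(y + 3) / 2, by linarith, by linarith, ?_, ?_⟩ <;>
        simp only [decide_eq_false_iff_not] <;> intro h <;> linarith
    · have := lt_of_le_of_ne hy h1
      exact ⟨3, hy, le_rfl, by simp only [decide_eq_false_iff_not]; intro h; linarith, by simp⟩
    · exact ⟨y, le_rfl, hy, by simp, by simpa using h1⟩
    · exact ⟨y, le_rfl, hy, by simp, by simpa using h1⟩
  have hx : (x = y' ↔ (xc && xd) = true) := by
    rw [h2, ← hyc, Bool.and_eq_true, decide_eq_true_eq, decide_eq_true_eq]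
    exact ⟨fun h => by constructor <;> linarith, fun h => by linarith [h.1, h.2]⟩
  have hxy' : x ≤ y' := hxy.trans hyy
  obtain ⟨x', hxx, hxy'', hxc, hxd⟩ :
      ∃ x', x ≤ x' ∧ x' ≤ y' ∧ decide (x' = x) = xc ∧ decide (x' = y') = xd := by
    cases xc <;> cases xd <;> simp at hx
    · have := lt_of_le_of_ne hxy' hx
      refine ⟨(x + y') / 2, by linarith, by linarith, ?_, ?_⟩ <;>
        simp only [decide_eq_false_iff_not] <;> intro h <;> linarith
    · have := lt_of_le_of_ne hxy' hx
      exact ⟨y', hxy', le_rfl, by simp only [decide_eq_false_iff_not]; intro h; linarith, by simp⟩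
    · exact ⟨x, le_rfl, hxy', by simp, by simpa using hx⟩
    · exact ⟨x, le_rfl, hxy', by simp, by simpa using hx⟩
  exact ⟨x', y', hxx, hxy'', hyy, hy3, by simp only [ladderStep, hyc, hyt, hxc, hxd]⟩

/-- The words of steps which are possible from a given state. -/
def ValidWord : {n : ℕ} → Bool × Bool → (Fin n → LadderStep) → Prop
  | 0, _, _ => True
  | _ + 1, σ, w => Valid σ (w 0) ∧ ValidWord (target (w 0)) (Fin.tail w)

/-- The inequalities between the first `n + 1` pairs of a ladder. -/
def IsLadder (n : ℕ) (X Y : ℕ → ℝ) : Prop :=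
  ∀ m < n, X m ≤ X (m + 1) ∧ X (m + 1) ≤ Y (m + 1) ∧ Y m ≤ Y (m + 1) ∧ Y (m + 1) ≤ 3

/-- The steps of a ladder. -/
noncomputable def ladderWord (n : ℕ) (X Y : ℕ → ℝ) : Fin n → LadderStep :=
  fun m => ladderStep (X m) (Y m) (X (m + 1)) (Y (m + 1))

theorem validWord_ladderWord {n : ℕ} : ∀ {X Y : ℕ → ℝ}, X 0 ≤ Y 0 → IsLadder n X Y →
    ValidWord (ladderState (X 0) (Y 0)) (ladderWord n X Y) := by
  induction n with
  | zero => intros; trivial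
  | succ n ih =>
    intro X Y h0 h
    obtain ⟨h1, h2, h3, h4⟩ := h 0 (by omega)
    refine ⟨valid_ladderStep h0 h1 h2 h3 h4, ?_⟩
    exact ih (X := fun m => X (m + 1)) (Y := fun m => Y (m + 1)) h2
      (fun m hm => h (m + 1) (by omega))

theorem exists_ladderWord_eq {n : ℕ} : ∀ {x y : ℝ} {w : Fin n → LadderStep}, x ≤ y → y ≤ 3 →
    ValidWord (ladderState x y) w →
    ∃ X Y : ℕ → ℝ, X 0 = x ∧ Y 0 = y ∧ IsLadder n X Y ∧ ladderWord n X Y = w := by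
  induction n with
  | zero =>
    intro x y w _ _ _
    exact ⟨fun _ => x, fun _ => y, rfl, rfl, fun m hm => by omega, Subsingleton.elim _ _⟩
  | succ n ih =>
    intro x y w hxy hy hw
    obtain ⟨x', y', h1, h2, h3, h4, hτ⟩ := exists_ladderStep_eq hxy hy hw.1
    have hw' : ValidWord (ladderState x' y') (Fin.tail w) := by
      have := hw.2
      rw [← hτ] at this
      exact this
    obtain ⟨X, Y, hX, hY, hl, hword⟩ := ih h2 h4 hw'
    -- The pair `(x, y)` is put in front of the ladder given by induction.
    refine ⟨fun m => Nat.casesOn m x X, fun m => Nat.casesOn m y Y, rfl, rfl, ?_, ?_⟩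
    · rintro (_ | m) hm
      · simpa [hX, hY] using ⟨h1, h2, h3, h4⟩
      · exact hl m (by omega)
    · ext1 m
      refine Fin.cases ?_ (fun i => ?_) m
      · rw [← hτ]
        simp [ladderWord, hX, hY]
      · exact congrFun hword i

theorem ladderWord_eq_iff {n : ℕ} {X Y X' Y' : ℕ → ℝ} :
    ladderWord n X Y = ladderWord n X' Y' ↔ ∀ m < n,
      (Y (m + 1) = Y m ↔ Y' (m + 1) = Y' m) ∧ (Y (m + 1) = 3 ↔ Y' (m + 1) = 3) ∧
      (X (m + 1) = X m ↔ X' (m + 1) = X' m) ∧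
      (X (m + 1) = Y (m + 1) ↔ X' (m + 1) = Y' (m + 1)) := by
  rw [funext_iff, Fin.forall_iff]
  simp only [ladderWord, ladderStep, Prod.mk.injEq, decide_eq_decide]

end Ladder

/-! ### Faces of the polytope of `α 2 3^k` as words of ladder steps. -/

section LadderGZ

open LadderStep

/-- The sequence `α 2 3^k`. -/
def ladderSeq (α : ℝ) (k : ℕ) : Fin (2 + k) → ℝ :=
  Fin.append ![α, 2] (fun _ : Fin k => 3)

variable {α : ℝ} {k : ℕ}

theorem gzTab_ladderSeq_zero_one (u : GZIndex (2 + k) → ℝ) :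
    gzTab (ladderSeq α k) u 0 1 = α := by
  rw [gzTab_zero _ _ le_rfl (by omega)]
  exact Fin.append_left ![α, 2] (fun _ : Fin k => (3 : ℝ)) 0

theorem gzTab_ladderSeq_zero_two (u : GZIndex (2 + k) → ℝ) :
    gzTab (ladderSeq α k) u 0 2 = 2 := by
  rw [gzTab_zero _ _ (by omega) (by omega)]
  exact Fin.append_left ![α, 2] (fun _ : Fin k => (3 : ℝ)) 1

theorem gzTab_ladderSeq_zero_of_three_le (u : GZIndex (2 + k) → ℝ) {j : ℕ} (hj : 3 ≤ j)
    (h : j ≤ 2 + k) : gzTab (ladderSeq α k) u 0 j = 3 := by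
  rw [gzTab_zero _ _ (by omega) h]
  have := Fin.append_right ![α, 2] (fun _ : Fin k => (3 : ℝ)) ⟨j - 3, by omega⟩
  rwa [show Fin.natAdd 2 (⟨j - 3, by omega⟩ : Fin k) = ⟨j - 1, by omega⟩ from
    Fin.ext (by simp only [Fin.val_natAdd]; omega)] at this

/-- The first column of the table. -/
def ladderX (α : ℝ) (u : GZIndex (2 + k) → ℝ) (m : ℕ) : ℝ :=
  gzTab (ladderSeq α k) u m 1

/-- The second column of the table, with its first entry repeated. -/
def ladderY (α : ℝ) (u : GZIndex (2 + k) → ℝ) : ℕ → ℝ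
  | 0 => 2
  | m + 1 => gzTab (ladderSeq α k) u m 2

theorem ladderY_one (u : GZIndex (2 + k) → ℝ) : ladderY α u 1 = 2 :=
  gzTab_ladderSeq_zero_two u

/-- Each such entry is squeezed between two entries equal to 3 in the row above. -/
theorem gzTab_of_mem_GZ {u : GZIndex (2 + k) → ℝ} (hu : u ∈ GZ (ladderSeq α k)) (i : ℕ) :
    ∀ {j : ℕ}, 3 ≤ j → i + j ≤ 2 + k → gzTab (ladderSeq α k) u i j = 3 := by
  rw [mem_GZ_iff] at hu
  induction i with
  | zero => exact fun hj h => gzTab_ladderSeq_zero_of_three_le u hj (by omega)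
  | succ i ih =>
    intro j hj h
    obtain ⟨h1, h2⟩ := hu i j (by omega) h
    rw [ih hj (by omega)] at h1
    rw [ih (by omega) (by omega)] at h2
    exact le_antisymm h2 h1

theorem isLadder_of_mem_GZ {u : GZIndex (2 + k) → ℝ} (hu : u ∈ GZ (ladderSeq α k)) :
    IsLadder (k + 1) (ladderX α u) (ladderY α u) := by
  intro m hm
  have hu' := mem_GZ_iff.1 hu
  obtain ⟨h1, h2⟩ := hu' m 1 le_rfl (by omega)
  refine ⟨h1, h2, ?_⟩
  cases m with
  | zero =>
    rw [ladderY_one]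
    exact ⟨le_rfl, by norm_num⟩
  | succ m =>
    obtain ⟨h3, h4⟩ := hu' m 2 (by omega) (by omega)
    rw [gzTab_of_mem_GZ hu m le_rfl (by omega)] at h4
    exact ⟨h3, h4⟩

theorem exists_mem_GZ_ladder {X Y : ℕ → ℝ} (hX : X 0 = α) (hY : Y 0 = 2) (hY1 : Y 1 = 2)
    (h : IsLadder (k + 1) X Y) :
    ∃ u ∈ GZ (ladderSeq α k), ladderWord (k + 1) (ladderX α u) (ladderY α u) =
      ladderWord (k + 1) X Y := by
  let u : GZIndex (2 + k) → ℝ := fun p =>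
    if p.1.2 = 1 then X p.1.1 else if p.1.2 = 2 then Y (p.1.1 + 1) else 3
  have h1 : ∀ i, i + 1 ≤ 2 + k → gzTab (ladderSeq α k) u i 1 = X i := by
    rintro (_ | i) hi
    · rw [gzTab_ladderSeq_zero_one, hX]
    · rw [gzTab_succ _ _ le_rfl hi]
      simp [u]
  have h2 : ∀ i, i + 2 ≤ 2 + k → gzTab (ladderSeq α k) u i 2 = Y (i + 1) := by
    rintro (_ | i) hi
    · rw [gzTab_ladderSeq_zero_two, hY1]
    · rw [gzTab_succ _ _ (by omega) hi]
      simp [u]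
  have h3 : ∀ i j, 3 ≤ j → i + j ≤ 2 + k → gzTab (ladderSeq α k) u i j = 3 := by
    rintro (_ | i) j hj hi
    · rw [gzTab_ladderSeq_zero_of_three_le _ hj (by omega)]
    · rw [gzTab_succ _ _ (by omega) hi]
      simp only [u]
      rw [if_neg (by omega), if_neg (by omega)]
  refine ⟨u, ?_, ?_⟩
  · rw [mem_GZ_iff]
    intro i j hj hij
    obtain rfl | rfl | hj3 : j = 1 ∨ j = 2 ∨ 3 ≤ j := by omega
    · rw [h1 i (by omega), h1 (i + 1) hij, h2 i (by omega)]
      have := h i (by omega)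
      exact ⟨this.1, this.2.1⟩
    · rw [h2 i (by omega), h2 (i + 1) hij, h3 i 3 le_rfl (by omega)]
      have := h (i + 1) (by omega)
      exact this.2.2
    · rw [h3 i j hj3 (by omega), h3 (i + 1) j hj3 hij, h3 i (j + 1) (by omega) (by omega)]
      exact ⟨le_rfl, le_rfl⟩
  · have hX' : ∀ m, m ≤ k + 1 → ladderX α u m = X m := fun m hm => h1 m (by omega)
    have hY' : ∀ m, m ≤ k + 1 → ladderY α u m = Y m := by
      rintro (_ | m) hm
      · exact hY.symm
      · exact h2 m (by omega)
    ext1 m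
    simp only [ladderWord]
    rw [hX' m (by omega), hX' (m + 1) (by omega), hY' m (by omega), hY' (m + 1) (by omega)]

theorem ladderWord_eq_iff_of_mem_GZ {u v : GZIndex (2 + k) → ℝ} (hu : u ∈ GZ (ladderSeq α k))
    (hv : v ∈ GZ (ladderSeq α k)) :
    ladderWord (k + 1) (ladderX α u) (ladderY α u) =
      ladderWord (k + 1) (ladderX α v) (ladderY α v) ↔
    ∀ i j, 1 ≤ j → i + 1 + j ≤ 2 + k →
      (gzTab (ladderSeq α k) u i j = gzTab (ladderSeq α k) u (i + 1) j ↔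
        gzTab (ladderSeq α k) v i j = gzTab (ladderSeq α k) v (i + 1) j) ∧
      (gzTab (ladderSeq α k) u (i + 1) j = gzTab (ladderSeq α k) u i (j + 1) ↔
        gzTab (ladderSeq α k) v (i + 1) j = gzTab (ladderSeq α k) v i (j + 1)) := by
  rw [ladderWord_eq_iff]
  constructor
  · intro h i j hj hij
    obtain rfl | rfl | hj3 : j = 1 ∨ j = 2 ∨ 3 ≤ j := by omega
    · obtain ⟨_, _, h3, h4⟩ := h i (by omega)
      rw [eq_comm, eq_comm (a := gzTab (ladderSeq α k) v i 1)]
      exact ⟨h3, h4⟩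
    · obtain ⟨h1, h2, _, _⟩ := h (i + 1) (by omega)
      rw [gzTab_of_mem_GZ hu i le_rfl (by omega), gzTab_of_mem_GZ hv i le_rfl (by omega)]
      rw [eq_comm, eq_comm (a := gzTab (ladderSeq α k) v i 2)]
      exact ⟨h1, h2⟩
    · rw [gzTab_of_mem_GZ hu i hj3 (by omega), gzTab_of_mem_GZ hv i hj3 (by omega),
        gzTab_of_mem_GZ hu (i + 1) hj3 hij, gzTab_of_mem_GZ hv (i + 1) hj3 hij,
        gzTab_of_mem_GZ hu i (by omega) (by omega), gzTab_of_mem_GZ hv i (by omega) (by omega)]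
      simp
  · intro h m hm
    obtain ⟨h1, h2⟩ := h m 1 le_rfl (by omega)
    rw [eq_comm, eq_comm (a := gzTab (ladderSeq α k) v m 1)] at h1
    rw [← and_assoc]
    refine ⟨?_, h1, h2⟩
    cases m with
    | zero =>
      rw [ladderY_one, ladderY_one]
      simp [ladderY]
    | succ m =>
      obtain ⟨h3, h4⟩ := h m 2 (by omega) (by omega)
      rw [gzTab_of_mem_GZ hu m le_rfl (by omega), gzTab_of_mem_GZ hv m le_rfl (by omega)] at h4
      rw [eq_comm, eq_comm (a := gzTab (ladderSeq α k) v m 2)] at h3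
      exact ⟨h3, h4⟩

theorem ncard_gzFree_ladder {u : GZIndex (2 + k) → ℝ} (hu : u ∈ GZ (ladderSeq α k)) :
    (gzFree (ladderSeq α k) u).ncard =
      ∑ m, weight (ladderWord (k + 1) (ladderX α u) (ladderY α u) m) := by
  classical
  set X := ladderX α u
  set Y := ladderY α u
  let S : Finset (ℕ × Bool) := (Finset.range (k + 1) ×ˢ Finset.univ).filter fun q =>
    if q.2 then Y (q.1 + 1) ≠ Y q.1 ∧ Y (q.1 + 1) ≠ 3
    else X (q.1 + 1) ≠ X q.1 ∧ X (q.1 + 1) ≠ Y (q.1 + 1)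
  have hS : ∑ m, weight (ladderWord (k + 1) X Y m) = S.card := by
    rw [Finset.card_filter, Finset.sum_product, Finset.sum_range]
    refine Finset.sum_congr rfl fun m _ => ?_
    rw [Fintype.sum_bool]
    simp [weight, ladderWord, ladderStep]
  -- Position `(i, 1)` is reached by step `i - 1`, but `(i, 2)` by step `i`, since `ladderY` is
  -- shifted by one row.
  let g : GZIndex (2 + k) → ℕ × Bool := fun p =>
    if p.1.2 = 1 then (p.1.1 - 1, false) else (p.1.1, true)
  have hfree : ∀ i j (h : 1 ≤ i + 1 ∧ 1 ≤ j ∧ i + 1 + j ≤ 2 + k),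
      (⟨(i + 1, j), h⟩ : GZIndex (2 + k)) ∈ gzFree (ladderSeq α k) u ↔
        (j = 1 ∧ X (i + 1) ≠ X i ∧ X (i + 1) ≠ Y (i + 1)) ∨
        (j = 2 ∧ Y (i + 2) ≠ Y (i + 1) ∧ Y (i + 2) ≠ 3) := by
    intro i j h
    obtain ⟨-, hj, hij⟩ := id h
    have hmem : (⟨(i + 1, j), h⟩ : GZIndex (2 + k)) ∈ gzFree (ladderSeq α k) u ↔
        gzTab (ladderSeq α k) u (i + 1) j ≠ gzTab (ladderSeq α k) u i j ∧
        gzTab (ladderSeq α k) u (i + 1) j ≠ gzTab (ladderSeq α k) u i (j + 1) := by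
      rw [gzFree, Set.mem_ofPred_eq, gzGap_false, gzGap_true, sub_ne_zero, sub_ne_zero, ne_comm]
    rw [hmem]
    obtain rfl | rfl | hj3 : j = 1 ∨ j = 2 ∨ 3 ≤ j := by omega
    · simp only [true_and, OfNat.one_ne_ofNat, false_and, or_false]
      exact Iff.rfl
    · rw [gzTab_of_mem_GZ hu i (j := 2 + 1) le_rfl (by omega)]
      simp only [OfNat.ofNat_ne_one, false_and, false_or, true_and]
      exact Iff.rfl
    · rw [gzTab_of_mem_GZ hu i hj3 (by omega), gzTab_of_mem_GZ hu (i + 1) hj3 hij]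
      simp only [ne_eq, not_true_eq_false, false_and, false_iff]
      omega
  have himage : g '' gzFree (ladderSeq α k) u = S := by
    ext ⟨m, b⟩
    rw [Finset.mem_coe, Finset.mem_filter]
    constructor
    · rintro ⟨⟨⟨_ | i, j⟩, h⟩, hp, hg⟩
      · simp at h
      · rw [hfree] at hp
        obtain ⟨-, hj, hij⟩ := id h
        obtain ⟨rfl, hp⟩ | ⟨rfl, hp⟩ := hp
        · obtain ⟨rfl, rfl⟩ : i = m ∧ false = b := by simpa [g] using hg
          refine ⟨by simp; omega, by simpa using hp⟩
        · obtain ⟨rfl, rfl⟩ : i + 1 = m ∧ true = b := by simpa [g] using hg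
          refine ⟨by simp; omega, by simpa using hp⟩
    · rintro ⟨hm, hb⟩
      have hm' : m < k + 1 := by simpa using hm
      cases b with
      | false =>
        refine ⟨⟨(m + 1, 1), by omega, le_rfl, by omega⟩, ?_, by simp [g]⟩
        rw [hfree]
        exact Or.inl ⟨rfl, by simpa using hb⟩
      | true =>
        cases m with
        | zero =>
          -- The repeated initial 2 makes the `y`-part of step 0 stationary, so it contributes no
          -- free position.
          have hb' : Y 1 ≠ Y 0 ∧ Y 1 ≠ 3 := by simpa using hb
          exact absurd (ladderY_one u) hb'.1
        | succ m =>
          refine ⟨⟨(m + 1, 2), by omega, by omega, by omega⟩, ?_, by simp [g]⟩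
          rw [hfree]
          exact Or.inr ⟨rfl, by simpa using hb⟩
  have hinj : Set.InjOn g (gzFree (ladderSeq α k) u) := by
    rintro ⟨⟨_ | i, j⟩, h⟩ hp ⟨⟨_ | i', j'⟩, h'⟩ hp' hg
    · simp at h
    · simp at h
    · simp at h'
    · rw [hfree] at hp hp'
      obtain ⟨rfl, -⟩ | ⟨rfl, -⟩ := hp <;> obtain ⟨rfl, -⟩ | ⟨rfl, -⟩ := hp' <;>
        simp [g] at hg <;> simp [hg]
  rw [hS, ← Set.ncard_coe_finset, ← himage, hinj.ncard_image]

open Classical in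
-- The condition on `(w 0).1` expresses that the first two entries of `ladderY` are both 2.
theorem fPolynomial_GZ_ladderSeq (hα : α ≤ 2) :
    fPolynomial (GZ (ladderSeq α k)) =
      ∑ w : Fin (k + 1) → LadderStep with
        ValidWord (ladderState α 2) w ∧ (w 0).1 = true, Polynomial.X ^ ∑ m, weight (w m) := by
  refine fPolynomial_GZ_eq_sum (ladderSeq α k) _
    (fun u => ladderWord (k + 1) (ladderX α u) (ladderY α u)) (fun w => ∑ m, weight (w m))
    ?_ ?_ (fun u hu v hv => ladderWord_eq_iff_of_mem_GZ hu hv) (fun u hu => ncard_gzFree_ladder hu)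
  · intro u hu
    rw [Finset.mem_filter]
    refine ⟨Finset.mem_univ _, ?_, ?_⟩
    · have := validWord_ladderWord (X := ladderX α u) (Y := ladderY α u)
        (by rwa [ladderX, gzTab_ladderSeq_zero_one]) (isLadder_of_mem_GZ hu)
      rwa [ladderX, gzTab_ladderSeq_zero_one] at this
    · exact decide_eq_true (ladderY_one u)
  · intro w hw
    obtain ⟨hw1, hw2⟩ := (Finset.mem_filter.1 hw).2
    obtain ⟨X, Y, hX, hY, hl, rfl⟩ := exists_ladderWord_eq hα (by norm_num) hw1
    have hY1 : Y 1 = 2 := by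
      simpa [ladderWord, ladderStep, hY] using hw2
    exact exists_mem_GZ_ladder hX hY hY1 hl

end LadderGZ

/-! ### Recurrences for the weighted numbers of words. -/

section Enumeration

open LadderStep

open Classical in
/-- The words of length `n` from the state `σ`, counted by the dimension of their faces. -/
noncomputable def ladderEnum (n : ℕ) (σ : Bool × Bool) : Polynomial ℤ :=
  ∑ w : Fin n → LadderStep with ValidWord σ w, Polynomial.X ^ ∑ m, weight (w m)

open Classical in
-- The predicate `q` serves both the plain recurrence and the restricted first step of a polytope
-- word.
theorem sum_validWord_succ (n : ℕ) (σ : Bool × Bool) (q : LadderStep → Prop)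
    [DecidablePred q] :
    (∑ w : Fin (n + 1) → LadderStep with ValidWord σ w ∧ q (w 0),
      (Polynomial.X : Polynomial ℤ) ^ ∑ m, weight (w m)) =
    ∑ τ : LadderStep with Valid σ τ ∧ q τ,
      Polynomial.X ^ weight τ * ladderEnum n (target τ) := by
  rw [Finset.sum_filter, ← (Fin.consEquiv fun _ : Fin (n + 1) => LadderStep).sum_comp,
    Fintype.sum_prod_type, Finset.sum_filter]
  refine Finset.sum_congr rfl fun τ _ => ?_
  have hcons : ∀ w : Fin n → LadderStep,
      (Fin.consEquiv fun _ : Fin (n + 1) => LadderStep) (τ, w) = Fin.cons τ w := fun _ => rfl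
  have hvalid : ∀ w : Fin n → LadderStep, ValidWord σ (Fin.cons τ w : Fin (n + 1) → LadderStep) ↔
      Valid σ τ ∧ ValidWord (target τ) w := fun w => by
    rw [ValidWord, Fin.cons_zero, Fin.tail_cons]
  simp only [hcons, hvalid, Fin.cons_zero, Fin.sum_univ_succ, Fin.cons_succ]
  split_ifs with h
  · simp only [h.1, h.2, true_and, and_true]
    rw [ladderEnum, Finset.mul_sum, Finset.sum_filter]
    simp only [pow_add]
  · refine Finset.sum_eq_zero fun w _ => if_neg fun h' => h ⟨h'.1.1, h'.2⟩

theorem ladderEnum_zero (σ : Bool × Bool) : ladderEnum 0 σ = 1 := by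
  simp [ladderEnum, ValidWord]

open Classical in
theorem ladderEnum_succ (n : ℕ) (σ : Bool × Bool) :
    ladderEnum (n + 1) σ = ∑ τ : LadderStep with Valid σ τ,
      Polynomial.X ^ weight τ * ladderEnum n (target τ) := by
  simpa [ladderEnum] using sum_validWord_succ n σ fun _ => True

theorem ladderEnum_true_true (n : ℕ) : ladderEnum n (true, true) = 1 := by
  induction n with
  | zero => exact ladderEnum_zero _
  | succ n ih =>
    rw [ladderEnum_succ, Finset.sum_filter]
    simp [Fintype.sum_prod_type, weight, Valid, target, ih]

theorem ladderEnum_succ_false_true (n : ℕ) :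
    ladderEnum (n + 1) (false, true) = (Polynomial.X + 1) * ladderEnum n (false, true) + 1 := by
  rw [ladderEnum_succ, Finset.sum_filter]
  simp [Fintype.sum_prod_type, weight, Valid, target, ladderEnum_true_true]
  ring

/-- Each coordinate stays, moves freely or reaches its upper bound, independently of the other. Not
reaching the bound has total weight `X + 1`, reaching it has weight 1. -/
theorem ladderEnum_succ_false_false (n : ℕ) :
    ladderEnum (n + 1) (false, false) =
      (Polynomial.X + 1) ^ 2 * ladderEnum n (false, false) +
      (Polynomial.X + 1) * ladderEnum n (true, false) +
      (Polynomial.X + 1) * ladderEnum n (false, true) + 1 := by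
  rw [ladderEnum_succ, Finset.sum_filter]
  simp [Fintype.sum_prod_type, weight, Valid, target, ladderEnum_true_true]
  ring

/-- If `y` stays, `x = y` is forced to stay too. So `x' < y' < 3` requires a free move of `y`, of
weight `X` rather than `X + 1`, and has total weight `X * (X + 1)`. -/
theorem ladderEnum_succ_true_false (n : ℕ) :
    ladderEnum (n + 1) (true, false) =
      ((Polynomial.X + 1) ^ 2 - (Polynomial.X + 1)) * ladderEnum n (false, false) +
      (Polynomial.X + 1) * ladderEnum n (true, false) +
      (Polynomial.X + 1) * ladderEnum n (false, true) + 1 := by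
  rw [ladderEnum_succ, Finset.sum_filter]
  simp [Fintype.sum_prod_type, weight, Valid, target, ladderEnum_true_true]
  ring

theorem fPolynomial_GZ_ladderSeq_of_lt {α : ℝ} (hα : α < 2) (k : ℕ) :
    fPolynomial (GZ (ladderSeq α k)) =
      (Polynomial.X + 1) * ladderEnum k (false, false) + ladderEnum k (true, false) := by
  classical
  rw [fPolynomial_GZ_ladderSeq hα.le, sum_validWord_succ k _ fun τ => τ.1 = true,
    Finset.sum_filter]
  simp [Fintype.sum_prod_type, weight, Valid, target, ladderState, hα.ne]
  ring

theorem fPolynomial_GZ_ladderSeq_two (k : ℕ) :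
    fPolynomial (GZ (ladderSeq 2 k)) = ladderEnum k (true, false) := by
  classical
  rw [fPolynomial_GZ_ladderSeq le_rfl, sum_validWord_succ k _ fun τ => τ.1 = true,
    Finset.sum_filter]
  simp [Fintype.sum_prod_type, weight, Valid, target, ladderState]

end Enumeration

/-! ### The linear system for the generating functions and its solution. -/

section GeneratingFunctions

open Polynomial (X)

/-- The generating function of the polynomials `ladderEnum k σ` in the variable `s = t + 1`. -/
noncomputable def ladderSeries (σ : Bool × Bool) : PowerSeries (Polynomial ℤ) :=
  PowerSeries.mk fun k => (ladderEnum k σ).comp (X - 1)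

theorem mk_eq_one_add_mul {R : Type*} [CommRing R] {f g : ℕ → R} (h0 : f 0 = 1)
    (h : ∀ n, f (n + 1) = g n) :
    PowerSeries.mk f = 1 + PowerSeries.X * PowerSeries.mk g := by
  ext n
  cases n with
  | zero => simp [h0]
  | succ n => simp [h, PowerSeries.coeff_succ_X_mul, PowerSeries.coeff_one]

theorem ladderSeries_true_true :
    ladderSeries (true, true) = 1 + zVar * ladderSeries (true, true) := by
  refine mk_eq_one_add_mul ?_ fun n => ?_ <;> simp [ladderEnum_true_true]

theorem ladderSeries_false_true :
    ladderSeries (false, true) =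
      1 + zVar * (sVar * ladderSeries (false, true) + ladderSeries (true, true)) := by
  have h : sVar * ladderSeries (false, true) + ladderSeries (true, true) =
      PowerSeries.mk fun k => X * (ladderEnum k (false, true)).comp (X - 1) + 1 := by
    ext1 n
    simp [ladderSeries, ladderEnum_true_true]
  rw [h]
  refine mk_eq_one_add_mul ?_ fun n => ?_
  · simp [ladderEnum_zero]
  · simp [ladderEnum_succ_false_true]

theorem ladderSeries_false_false :
    ladderSeries (false, false) =
      1 + zVar * (sVar ^ 2 * ladderSeries (false, false) + sVar * ladderSeries (true, false) +
        sVar * ladderSeries (false, true) + ladderSeries (true, true)) := by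
  have h : sVar ^ 2 * ladderSeries (false, false) + sVar * ladderSeries (true, false) +
        sVar * ladderSeries (false, true) + ladderSeries (true, true) =
      PowerSeries.mk fun k => (ladderEnum (k + 1) (false, false)).comp (X - 1) := by
    ext1 n
    simp [ladderSeries, ladderEnum_true_true, ladderEnum_succ_false_false, ← map_pow]
  rw [h]
  exact mk_eq_one_add_mul (by simp [ladderEnum_zero]) fun n => rfl

theorem ladderSeries_true_false :
    ladderSeries (true, false) =
      1 + zVar * ((sVar ^ 2 - sVar) * ladderSeries (false, false) +
        sVar * ladderSeries (true, false) +
        sVar * ladderSeries (false, true) + ladderSeries (true, true)) := by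
  have h : (sVar ^ 2 - sVar) * ladderSeries (false, false) + sVar * ladderSeries (true, false) +
        sVar * ladderSeries (false, true) + ladderSeries (true, true) =
      PowerSeries.mk fun k => (ladderEnum (k + 1) (true, false)).comp (X - 1) := by
    ext1 n
    simp [ladderSeries, ladderEnum_true_true, ladderEnum_succ_true_false, ← map_pow, ← map_sub]
  rw [h]
  exact mk_eq_one_add_mul (by simp [ladderEnum_zero]) fun n => rfl

/-- The recurrences of the two states differ only by the term `s` times the series of `(false,
false)`. -/
theorem ladderSeries_true_false_eq :
    ladderSeries (true, false) = (1 - sVar * zVar) * ladderSeries (false, false) := by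
  linear_combination ladderSeries_true_false - ladderSeries_false_false

theorem ladderSeries_false_false_mul_gzDenominator :
    ladderSeries (false, false) * gzDenominator = 1 := by
  have hS : (1 - zVar) * ladderSeries (true, true) = 1 := by
    linear_combination ladderSeries_true_true
  have hR : (1 - sVar * zVar) * ladderSeries (false, true) = 1 + zVar * ladderSeries (true, true) := by
    linear_combination ladderSeries_false_true
  -- Once the series of `(true, false)` is eliminated, what remains on the right is the right-hand
  -- side of the equation for `(false, true)`.
  have hP : ladderSeries (false, false) * (sVar ^ 2 * zVar ^ 2 - (sVar ^ 2 + sVar) * zVar + 1) =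
      ladderSeries (false, true) := by
    linear_combination ladderSeries_false_false + zVar * sVar * ladderSeries_true_false_eq
      - ladderSeries_false_true
  rw [gzDenominator]
  linear_combination (1 - zVar) * (1 - sVar * zVar) * hP + (1 - zVar) * hR + zVar * hS

theorem isUnit_gzDenominator : IsUnit gzDenominator :=
  IsUnit.of_mul_eq_one_right _ ladderSeries_false_false_mul_gzDenominator

theorem ladderSeries_false_false_eq_inverse :
    ladderSeries (false, false) = Ring.inverse gzDenominator := by
  rw [← mul_one (ladderSeries _), ← Ring.mul_inverse_cancel _ isUnit_gzDenominator, ← mul_assoc,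
    ladderSeries_false_false_mul_gzDenominator, one_mul]

end GeneratingFunctions

theorem mainTheorem4 :
    -- the denominator is invertible in `ℤ[s]⟦z⟧`, so that fractions make sense there
    IsUnit gzDenominator ∧
    -- A) `∑ h_{GZ(1 2 3^k)}(s) z^k`
    PowerSeries.mk (fun k => hPolynomial (GZ (seq123 k))) =
      (-(sVar * zVar) + sVar + 1) * Ring.inverse gzDenominator ∧
    -- B) `∑ h_{GZ(2^2 3^k)}(s) z^k`
    PowerSeries.mk (fun k => hPolynomial (GZ (seq223 k))) =
      (-(sVar * zVar) + 1) * Ring.inverse gzDenominator := by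
  refine ⟨isUnit_gzDenominator, ?_, ?_⟩
  · have h : PowerSeries.mk (fun k => hPolynomial (GZ (seq123 k))) =
        sVar * ladderSeries (false, false) + ladderSeries (true, false) := by
      ext1 k
      -- `seq123 k` and `ladderSeq 1 k` agree by definition.
      have hk : fPolynomial (GZ (seq123 k)) = _ :=
        fPolynomial_GZ_ladderSeq_of_lt (α := 1) (by norm_num) k
      simp [hPolynomial, hk, ladderSeries]
    rw [h, ← ladderSeries_false_false_eq_inverse, ladderSeries_true_false_eq]
    ring
  · have h : PowerSeries.mk (fun k => hPolynomial (GZ (seq223 k))) =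
        ladderSeries (true, false) := by
      ext1 k
      have hk : fPolynomial (GZ (seq223 k)) = _ := fPolynomial_GZ_ladderSeq_two k
      simp [hPolynomial, hk, ladderSeries]
    rw [h, ← ladderSeries_false_false_eq_inverse, ladderSeries_true_false_eq]
    ring
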